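/- Let $T\subseteq\mathbb R$ be an open (possibly unbounded) interval, and let $A\in L^1_{\mathrm{loc}}(T,\mathbb C^{n\times n})$, $B\in L^2_{\mathrm{loc}}(T,\mathbb C^{n\times m})$, $C\in L^2_{\mathrm{loc}}(T,\mathbb C^{m\times n})$, $D\in L^\infty_{\mathrm{loc}}(T,\mathbb C^{m\times m})$. Consider the linear time-varying system $$\dot x(t)=A(t)x(t)+B(t)u(t),\qquad y(t)=C(t)x(t)+D(t)u(t)\qquad\text{for a.e. } t\in T,$$ with solutions $(x,u,y)$, where $x\in W^{1,1}_{\mathrm{loc}}(T,\mathbb C^n)$ (identified with its continuous, locally absolutely continuous, representative) and $u,y\in L^2_{\mathrm{loc}}(T,\mathbb C^m)$. A function $V:T\times\mathbb C^n\to[0,\infty)$ is a *storage function* for the system if $V(t,0)=0$ for all $t\in T$ and $$V(t_1,x(t_1))-V(t_0,x(t_0))\le\int_{t_0}^{t_1}\operatorname{Re}\big(y(t)^Hu(t)\big)\,dt$$ for all $t_0\le t_1$ in $T$ and all solutions $(x,u,y)$. Let $Q(t)\in\mathbb C^{n\times n}$ be Hermitian positive semidefinite for every $t\in T$, and put $V_Q(t,x)=\tfrac12x^HQ(t)x$.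 We say that $Q$ *solves the differential KYP inequality* if for a.e. $t\in T$ the classical derivative $\dot Q(t)$ exists and $$\begin{bmatrix}-A(t)^HQ(t)-Q(t)A(t)-\dot Q(t) & C(t)^H-Q(t)B(t)\\ C(t)-B(t)^HQ(t) & D(t)+D(t)^H\end{bmatrix}\ge 0$$ (Hermitian positive semidefinite). We call $Q$ *locally absolutely upper semicontinuous* on $T$ if for all $t_0\le t_1$ in $T$ and all $x\in\mathbb C^n$ there is $g\in L^1([t_0,t_1],\mathbb R)$ with $\tfrac12x^HQ(s)x-\tfrac12x^HQ(r)x\le\int_r^sg(t)\,dt$ whenever $t_0\le r\le s\le t_1$. 1. If $Q$ has bounded variation on every compact subinterval of $T$ and $V_Q$ is a storage function for the system, then $Q$ solves the differential KYP inequality. 2. Conversely, if $Q$ is locally absolutely upper semicontinuous on $T$ and solves the differential KYP inequality, then $V_Q$ is a storage function for the system. -/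

import Mathlib

open MeasureTheory Matrix
open scoped ENNReal ComplexOrder

/-- `f ∈ L^p_loc(T)`: the restriction of `f` to every compact subset of `T` is in `L^p`. -/
def LpLocOn (f : ℝ → ℂ) (p : ℝ≥0∞) (T : Set ℝ) : Prop :=
  ∀ K : Set ℝ, IsCompact K → K ⊆ T → MemLp f p (volume.restrict K)

/-- Matrix functions all of whose entries are in `L^p_loc(T)`. -/
def MatrixLpLocOn {k l : ℕ} (F : ℝ → Matrix (Fin k) (Fin l) ℂ) (p : ℝ≥0∞) (T : Set ℝ) : Prop :=
  ∀ i j, LpLocOn (fun t => F t i j) p T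

/-- Vector functions all of whose entries are in `L^p_loc(T)`. -/
def VectorLpLocOn {k : ℕ} (f : ℝ → Fin k → ℂ) (p : ℝ≥0∞) (T : Set ℝ) : Prop :=
  ∀ i, LpLocOn (fun t => f t i) p T

/-- `x ∈ W^{1,1}_loc(T, ℂ^k)` for an interval `T`, for the continuous representative (the one that
is evaluated at points): `x` is absolutely continuous on every compact subinterval of `T`. -/
def W11LocOn {k : ℕ} (x : ℝ → Fin k → ℂ) (T : Set ℝ) : Prop :=
  ∀ a ∈ T, ∀ b ∈ T, AbsolutelyContinuousOnInterval x a b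

/-- The data of a linear time-varying system `ẋ = A x + B u`, `y = C x + D u` on an open, possibly
unbounded, time interval `T`. Only the values of the coefficients on `T` are relevant. -/
structure LTVSystem (n m : ℕ) where
  /-- the time interval -/
  T : Set ℝ
  isOpen_T : IsOpen T
  ordConnected_T : T.OrdConnected
  A : ℝ → Matrix (Fin n) (Fin n) ℂ
  B : ℝ → Matrix (Fin n) (Fin m) ℂ
  C : ℝ → Matrix (Fin m) (Fin n) ℂ
  D : ℝ → Matrix (Fin m) (Fin m) ℂ
  A_mem : MatrixLpLocOn A 1 T
  B_mem : MatrixLpLocOn B 2 T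
  C_mem : MatrixLpLocOn C 2 T
  D_mem : MatrixLpLocOn D ∞ T

/-- `(x, u, y)` is a state-input-output solution of the system. -/
structure LTVSystem.IsSolution {n m : ℕ} (S : LTVSystem n m)
    (x : ℝ → Fin n → ℂ) (u y : ℝ → Fin m → ℂ) : Prop where
  state_mem : W11LocOn x S.T
  input_mem : VectorLpLocOn u 2 S.T
  output_mem : VectorLpLocOn y 2 S.T
  state_eq : ∀ᵐ t ∂(volume.restrict S.T), HasDerivAt x (S.A t *ᵥ x t + S.B t *ᵥ u t) t
  output_eq : ∀ᵐ t ∂(volume.restrict S.T), y t = S.C t *ᵥ x t + S.D t *ᵥ u t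

/-- `V : T × ℂⁿ → [0, ∞)` is a storage function of the system (only the values of `V t` for `t ∈ T`
are relevant). -/
structure LTVSystem.IsStorageFunction {n m : ℕ} (S : LTVSystem n m)
    (V : ℝ → (Fin n → ℂ) → ℝ) : Prop where
  nonneg : ∀ t ∈ S.T, ∀ x, 0 ≤ V t x
  zero : ∀ t ∈ S.T, V t 0 = 0
  dissipation : ∀ (x : ℝ → Fin n → ℂ) (u y : ℝ → Fin m → ℂ), S.IsSolution x u y →
    ∀ t₀ ∈ S.T, ∀ t₁ ∈ S.T, t₀ ≤ t₁ →
      V t₁ (x t₁) - V t₀ (x t₀) ≤ ∫ t in t₀..t₁, (star (y t) ⬝ᵥ u t).re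

/-- The quadratic form `V_Q(t, x) = ½ xᴴ Q(t) x`, which is real where `Q(t)` is Hermitian. -/
noncomputable def quadStorage {n : ℕ} (Q : ℝ → Matrix (Fin n) (Fin n) ℂ)
    (t : ℝ) (x : Fin n → ℂ) : ℝ :=
  (1 / 2) * (star x ⬝ᵥ (Q t *ᵥ x)).re

open scoped Matrix.Norms.L2Operator in
/-- `Q ∈ BV_loc(T, ℂ^{n,n})`: the total variation, with respect to the induced 2-norm, is finite on
every compact subinterval of the interval `T`. -/
def MatrixBVLocOn {n : ℕ} (Q : ℝ → Matrix (Fin n) (Fin n) ℂ) (T : Set ℝ) : Prop :=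
  LocallyBoundedVariationOn Q T

/-- `f` is absolutely upper semicontinuous on `[t₀, t₁]`: its increments are bounded from above by
the integrals of some `g ∈ L¹([t₀, t₁], ℝ)`. -/
def AUCOn (f : ℝ → ℝ) (t₀ t₁ : ℝ) : Prop :=
  ∃ g : ℝ → ℝ, IntegrableOn g (Set.Icc t₀ t₁) ∧
    ∀ r ∈ Set.Icc t₀ t₁, ∀ s ∈ Set.Icc t₀ t₁, r ≤ s → f s - f r ≤ ∫ t in r..s, g t

/-- A pointwise Hermitian matrix function is locally absolutely upper semicontinuous on the interval
`T` if `t ↦ ½ xᴴ Q(t) x` is absolutely upper semicontinuous on every compact subinterval of `T`, for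
every `x ∈ ℂⁿ`. -/
def MatrixAUCLocOn {n : ℕ} (Q : ℝ → Matrix (Fin n) (Fin n) ℂ) (T : Set ℝ) : Prop :=
  (∀ t ∈ T, (Q t).IsHermitian) ∧
    ∀ t₀ ∈ T, ∀ t₁ ∈ T, t₀ ≤ t₁ → ∀ x : Fin n → ℂ, AUCOn (fun t => quadStorage Q t x) t₀ t₁

/-- `Q` solves the differential Kalman-Yakubovich-Popov inequality: for almost every `t ∈ T`, the
classical derivative of `Q` at `t` exists and the block matrix formed with it is Hermitian positive
semidefinite. -/
def LTVSystem.SolvesKYP {n m : ℕ} (S : LTVSystem n m)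
    (Q : ℝ → Matrix (Fin n) (Fin n) ℂ) : Prop :=
  ∀ᵐ t ∂(volume.restrict S.T), ∃ Q' : Matrix (Fin n) (Fin n) ℂ, HasDerivAt Q Q' t ∧
    (fromBlocks
      (-((S.A t)ᴴ * Q t) - Q t * S.A t - Q') ((S.C t)ᴴ - Q t * S.B t)
      (S.C t - (S.B t)ᴴ * Q t)               (S.D t + (S.D t)ᴴ)).PosSemidef

/-! Where `Q` and a trajectory `x` are differentiable, the block form of the KYP inequality at
`(x(t), u(t))` equals twice the supply rate minus twice the derivative of `V_Q(t, x(t))`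
(`kyp_form_re`, `hasDerivAt_quadStorage`). The KYP inequality is thus the differentiated dissipation
inequality. Two things need proof: that the pointwise inequality may be integrated, and that
inequalities along single trajectories give a matrix inequality outside one null set.

Sufficiency. An absolutely upper semicontinuous function is a primitive minus a monotone function,
so by Lebesgue its increments are at most the integral of its derivative (`AUCOn.deriv_spec`). It
remains to see that `V_Q(t, x(t))` is of this kind (`MatrixAUCLocOn.aucOn_quadStorage_comp`). The
hypothesis gives a majorant for each fixed vector only. Since a Hermitian matrix is controlled by
its form at finitely many test vectors (`Matrix.entrySum_le_polarSum`), both a bound on `Q` and a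
majorant uniform in the vector follow.

Necessity. Bounded variation makes `Q` differentiable almost everywhere. Near `t₀`, take `n + m`
solutions with constant inputs whose initial state and input run through the standard basis of
`ℂ^(n+m)`; they exist by the Peano-Baker series (`exists_linear_integral_equation`). Supplied minus
stored energy is monotone along every linear combination, so the block form is nonnegative on the
span of the vectors `(xᵢ(t), vᵢ)`, with a null set that does not depend on the coefficients
(`LTVSystem.IsStorageFunction.ae_kyp_form_nonneg`). By continuity of the determinant this span is
everything for `t` near `t₀`. -/

/-! ### Absolutely continuous and absolutely upper semicontinuous functions. -/

/-- A property that holds almost everywhere on compact subintervals of an open set holds almost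
everywhere on it. -/
lemma ae_restrict_of_forall_Icc {T : Set ℝ} (hT : IsOpen T) {P : ℝ → Prop}
    (h : ∀ a ∈ T, ∀ b ∈ T, Set.Icc a b ⊆ T → a < b → ∀ᵐ t, t ∈ Set.Icc a b → P t) :
    ∀ᵐ t ∂(volume.restrict T), P t := by
  rw [ae_restrict_iff' hT.measurableSet, ae_iff]
  refine measure_null_of_locally_null _ fun t ht => ?_
  simp only [Set.mem_ofPred_eq, Classical.not_imp] at ht
  obtain ⟨ε, hε, hball⟩ := Metric.isOpen_iff.1 hT t ht.1
  have hsub : Set.Icc (t - ε / 2) (t + ε / 2) ⊆ T := fun s hs => hball <| by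
    rw [Metric.mem_ball, Real.dist_eq, abs_lt]
    constructor <;> linarith [hs.1, hs.2]
  refine ⟨{s | ¬(s ∈ T → P s)} ∩ Set.Icc (t - ε / 2) (t + ε / 2),
    Filter.inter_mem self_mem_nhdsWithin
      (mem_nhdsWithin_of_mem_nhds (Icc_mem_nhds (by linarith) (by linarith))), ?_⟩
  have := h _ (hsub (Set.left_mem_Icc.2 (by linarith))) _
    (hsub (Set.right_mem_Icc.2 (by linarith))) hsub (by linarith)
  rw [ae_iff] at this
  refine measure_mono_null (fun s hs => ?_) this
  simp only [Set.mem_inter_iff, Set.mem_ofPred_eq, Classical.not_imp] at hs ⊢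
  exact ⟨hs.2, hs.1.2⟩

/-- Serves to pass to components and to real and imaginary parts, and to compare a vector-valued
primitive with the primitive of a norm. -/
lemma AbsolutelyContinuousOnInterval.of_dist_le {X Y : Type*} [PseudoMetricSpace X]
    [PseudoMetricSpace Y] {f : ℝ → X} {g : ℝ → Y} {a b : ℝ}
    (hg : AbsolutelyContinuousOnInterval g a b)
    (h : ∀ s ∈ Set.uIcc a b, ∀ t ∈ Set.uIcc a b, dist (f s) (f t) ≤ dist (g s) (g t)) :
    AbsolutelyContinuousOnInterval f a b := by
  rw [absolutelyContinuousOnInterval_iff] at hg ⊢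
  intro ε hε
  obtain ⟨δ, hδ, H⟩ := hg ε hε
  refine ⟨δ, hδ, fun E hE hlt => lt_of_le_of_lt (Finset.sum_le_sum fun i hi => ?_) (H E hE hlt)⟩
  exact h _ (hE.1 i hi).1 _ (hE.1 i hi).2

/-- An absolutely continuous complex function has an integrable majorant of its increments. -/
lemma AbsolutelyContinuousOnInterval.exists_norm_sub_le_integral_complex {f : ℝ → ℂ} {a b : ℝ}
    (hf : AbsolutelyContinuousOnInterval f a b) (hab : a ≤ b) :
    ∃ g : ℝ → ℝ, IntegrableOn g (Set.Icc a b) ∧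
      ∀ r ∈ Set.Icc a b, ∀ s ∈ Set.Icc a b, r ≤ s → ‖f s - f r‖ ≤ ∫ t in r..s, g t := by
  have hre : AbsolutelyContinuousOnInterval (fun t => (f t).re) a b :=
    hf.of_dist_le fun s _ t _ => by
      rw [Real.dist_eq, dist_eq_norm, ← Complex.sub_re]; exact Complex.abs_re_le_norm _
  have him : AbsolutelyContinuousOnInterval (fun t => (f t).im) a b :=
    hf.of_dist_le fun s _ t _ => by
      rw [Real.dist_eq, dist_eq_norm, ← Complex.sub_im]; exact Complex.abs_im_le_norm _
  have i1 := hre.intervalIntegrable_deriv.norm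
  have i2 := him.intervalIntegrable_deriv.norm
  refine ⟨fun t => ‖deriv (fun t => (f t).re) t‖ + ‖deriv (fun t => (f t).im) t‖,
    (intervalIntegrable_iff_integrableOn_Icc_of_le hab).1 (i1.add i2), fun r hr s hs hrs => ?_⟩
  have hsub : Set.uIcc r s ⊆ Set.uIcc a b := by
    rw [Set.uIcc_of_le hab, Set.uIcc_of_le hrs]; exact Set.Icc_subset_Icc hr.1 hs.2
  rw [intervalIntegral.integral_add (i1.mono_set hsub) (i2.mono_set hsub)]
  refine (Complex.norm_le_abs_re_add_abs_im _).trans (add_le_add ?_ ?_)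
  · rw [Complex.sub_re, ← (hre.mono hsub).integral_deriv_eq_sub, ← Real.norm_eq_abs]
    exact intervalIntegral.norm_integral_le_integral_norm hrs
  · rw [Complex.sub_im, ← (him.mono hsub).integral_deriv_eq_sub, ← Real.norm_eq_abs]
    exact intervalIntegral.norm_integral_le_integral_norm hrs

lemma AbsolutelyContinuousOnInterval.exists_norm_sub_le_integral {k : ℕ} {f : ℝ → Fin k → ℂ}
    {a b : ℝ} (hf : AbsolutelyContinuousOnInterval f a b) (hab : a ≤ b) :
    ∃ g : ℝ → ℝ, IntegrableOn g (Set.Icc a b) ∧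
      ∀ r ∈ Set.Icc a b, ∀ s ∈ Set.Icc a b, r ≤ s → ‖f s - f r‖ ≤ ∫ t in r..s, g t := by
  have hi (i) : AbsolutelyContinuousOnInterval (fun t => f t i) a b :=
    hf.of_dist_le fun s _ t _ => dist_le_pi_dist _ _ i
  choose g hg hgle using fun i => (hi i).exists_norm_sub_le_integral_complex hab
  refine ⟨fun t => ∑ i, g i t, integrable_finsetSum _ fun i _ => hg i, fun r hr s hs hrs => ?_⟩
  have hsub : Set.Icc r s ⊆ Set.Icc a b := Set.Icc_subset_Icc hr.1 hs.2
  rw [intervalIntegral.integral_finsetSum fun i _ =>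
    (intervalIntegrable_iff_integrableOn_Icc_of_le hrs).2 ((hg i).mono_set hsub)]
  have h0 (i) : 0 ≤ ∫ t in r..s, g i t := (norm_nonneg _).trans (hgle i r hr s hs hrs)
  refine (pi_norm_le_iff_of_nonneg (Finset.sum_nonneg fun i _ => h0 i)).2 fun i => ?_
  exact (hgle i r hr s hs hrs).trans
    (Finset.single_le_sum (f := fun i => ∫ t in r..s, g i t) (fun i _ => h0 i) (Finset.mem_univ i))

lemma AUCOn.mono {f : ℝ → ℝ} {a b c d : ℝ} (hf : AUCOn f a b)
    (h : Set.Icc c d ⊆ Set.Icc a b) : AUCOn f c d := by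
  obtain ⟨g, hg, hle⟩ := hf
  exact ⟨g, hg.mono_set h, fun r hr s hs => hle r (h hr) s (h hs)⟩

/-- Absolutely upper semicontinuous functions are differentiable almost everywhere, with an
integrable derivative whose integral bounds the increment from above. -/
lemma AUCOn.deriv_spec {f : ℝ → ℝ} {a b : ℝ} (hf : AUCOn f a b) (hab : a ≤ b) :
    (∀ᵐ t, t ∈ Set.Icc a b → DifferentiableAt ℝ f t) ∧
      IntervalIntegrable (deriv f) volume a b ∧ f b - f a ≤ ∫ t in a..b, deriv f t := by
  obtain ⟨g, hg, hle⟩ := hf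
  have hgi : IntervalIntegrable g volume a b :=
    (intervalIntegrable_iff_integrableOn_Icc_of_le hab).2 hg
  have hsubi {r s : ℝ} (hr : r ∈ Set.Icc a b) (hs : s ∈ Set.Icc a b) :
      IntervalIntegrable g volume r s :=
    hgi.mono_set (by rw [Set.uIcc_of_le hab]; exact Set.uIcc_subset_Icc hr hs)
  set G : ℝ → ℝ := fun t => ∫ s in a..t, g s with hG
  -- Monotonicity of `h` is exactly the majorant inequality, and `f = G - h`.
  set h : ℝ → ℝ := fun t => G t - f t with hh
  have ha : a ∈ Set.Icc a b := Set.left_mem_Icc.2 hab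
  have hb : b ∈ Set.Icc a b := Set.right_mem_Icc.2 hab
  have hmono : MonotoneOn h (Set.uIcc a b) := by
    rw [Set.uIcc_of_le hab]
    intro r hr s hs hrs
    have h1 := hle r hr s hs hrs
    have h2 : G r + ∫ t in r..s, g t = G s :=
      intervalIntegral.integral_add_adjacent_intervals (hsubi ha hr) (hsubi hr hs)
    simp only [hh]; linarith
  have hhi := hmono.intervalIntegrable_deriv
  -- The only loss: `h` may have jumps and a singular part, which its derivative does not see. They
  -- correspond to drops of `f`, so the final inequality points the right way.
  have hhle : ∫ t in a..b, deriv h t ≤ h b - h a := by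
    have h1 := hmono.intervalIntegral_deriv_mem_uIcc
    have h2 : h a ≤ h b := hmono (by simp) (by simp) hab
    rw [Set.uIcc_of_le (by linarith)] at h1
    exact h1.2
  have hbv : BoundedVariationOn h (Set.uIcc a b) := by
    refine ne_top_of_le_ne_top ENNReal.ofReal_ne_top
      (b := ENNReal.ofReal (h b - h a)) ?_
    rw [Set.uIcc_of_le hab] at hmono ⊢
    simpa using (hmono.eVariationOn_eq ha hb).le
  have hdiff : ∀ᵐ t, t ∈ Set.Icc a b → DifferentiableAt ℝ f t ∧ deriv f t = g t - deriv h t := by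
    filter_upwards [hbv.ae_differentiableAt_of_mem_uIcc, hgi.ae_hasDerivAt_integral] with t h1 h2 ht
    rw [Set.uIcc_of_le hab] at h1 h2
    have h3 : HasDerivAt (fun t => G t - h t) (g t - deriv h t) t :=
      (h2 ht a ha).sub (h1 ht).hasDerivAt
    have h4 : (fun t => G t - h t) = f := by ext t; simp [hh]
    rw [h4] at h3
    exact ⟨h3.differentiableAt, h3.deriv⟩
  have hcongr : (fun t => g t - deriv h t) =ᵐ[volume.restrict (Set.uIoc a b)] deriv f := by
    rw [Filter.EventuallyEq, ae_restrict_iff' measurableSet_uIoc]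
    filter_upwards [hdiff] with t ht htab
    refine (ht ?_).2.symm
    rw [Set.uIoc_of_le hab] at htab
    exact Set.Ioc_subset_Icc_self htab
  refine ⟨hdiff.mono fun t ht hm => (ht hm).1, (hgi.sub hhi).congr_ae hcongr, ?_⟩
  rw [← intervalIntegral.integral_congr_ae_restrict hcongr, intervalIntegral.integral_sub hgi hhi]
  have hGb : G b = ∫ t in a..b, g t := rfl
  have hGa : G a = 0 := intervalIntegral.integral_same
  simp only [hh] at hhle
  linarith

/-! ### Bounds and polarization for quadratic forms. -/

/-- The entrywise 1-norm of a matrix. -/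
noncomputable def Matrix.entrySum {k l : ℕ} (M : Matrix (Fin k) (Fin l) ℂ) : ℝ := ∑ i, ∑ j, ‖M i j‖

lemma Matrix.entrySum_nonneg {k l : ℕ} (M : Matrix (Fin k) (Fin l) ℂ) : 0 ≤ M.entrySum :=
  Finset.sum_nonneg fun _ _ => Finset.sum_nonneg fun _ _ => norm_nonneg _

lemma Matrix.norm_star_dotProduct_mulVec_le {k l : ℕ} (M : Matrix (Fin k) (Fin l) ℂ)
    (x : Fin k → ℂ) (y : Fin l → ℂ) : ‖star x ⬝ᵥ (M *ᵥ y)‖ ≤ M.entrySum * (‖x‖ * ‖y‖) := by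
  simp only [dotProduct, mulVec, Matrix.entrySum, Finset.sum_mul, Finset.mul_sum]
  refine (norm_sum_le _ _).trans (Finset.sum_le_sum fun i _ => ?_)
  refine (norm_sum_le _ _).trans (Finset.sum_le_sum fun j _ => ?_)
  rw [norm_mul, norm_mul, Pi.star_apply, norm_star]
  calc ‖x i‖ * (‖M i j‖ * ‖y j‖) = ‖M i j‖ * (‖x i‖ * ‖y j‖) := by ring
    _ ≤ _ := by gcongr <;> exact norm_le_pi_norm _ _

/-- The real quadratic form `x ↦ ½ Re (xᴴ M x)`. -/
noncomputable def Matrix.halfForm {n : ℕ} (M : Matrix (Fin n) (Fin n) ℂ) (x : Fin n → ℂ) : ℝ :=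
  (1 / 2) * (star x ⬝ᵥ (M *ᵥ x)).re

lemma Matrix.abs_halfForm_le {n : ℕ} (M : Matrix (Fin n) (Fin n) ℂ) (x : Fin n → ℂ) :
    |M.halfForm x| ≤ M.entrySum * ‖x‖ ^ 2 := by
  have h := (Complex.abs_re_le_norm _).trans (M.norm_star_dotProduct_mulVec_le x x)
  rw [Matrix.halfForm, abs_mul, abs_of_pos (by norm_num : (0:ℝ) < 1 / 2), sq]
  linarith [abs_nonneg (star x ⬝ᵥ (M *ᵥ x)).re]

lemma Matrix.halfForm_sub_le {n : ℕ} (M : Matrix (Fin n) (Fin n) ℂ) {x y : Fin n → ℂ} {R : ℝ}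
    (hx : ‖x‖ ≤ R) (hy : ‖y‖ ≤ R) :
    M.halfForm x - M.halfForm y ≤ M.entrySum * R * ‖x - y‖ := by
  -- Each of the two terms is at most `M.entrySum * R * ‖x - y‖` in norm; the factor ½ of the form
  -- compensates for their number.
  have h : star x ⬝ᵥ (M *ᵥ x) - star y ⬝ᵥ (M *ᵥ y) =
      star x ⬝ᵥ (M *ᵥ (x - y)) + star (x - y) ⬝ᵥ (M *ᵥ y) := by
    simp only [mulVec_sub, dotProduct_sub, star_sub, sub_dotProduct]; ring
  have h1 : M.halfForm x - M.halfForm y =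
      (1 / 2) * (star x ⬝ᵥ (M *ᵥ (x - y)) + star (x - y) ⬝ᵥ (M *ᵥ y)).re := by
    rw [← h, Complex.sub_re, Matrix.halfForm, Matrix.halfForm]; ring
  rw [h1]
  have h2 := (Complex.re_le_norm _).trans (norm_add_le (star x ⬝ᵥ (M *ᵥ (x - y)))
    (star (x - y) ⬝ᵥ (M *ᵥ y)))
  have h3 := M.norm_star_dotProduct_mulVec_le x (x - y)
  have h4 := M.norm_star_dotProduct_mulVec_le (x - y) y
  have h5 : M.entrySum * (‖x‖ * ‖x - y‖) ≤ M.entrySum * (R * ‖x - y‖) :=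
    mul_le_mul_of_nonneg_left (mul_le_mul_of_nonneg_right hx (norm_nonneg _)) M.entrySum_nonneg
  have h6 : M.entrySum * (‖x - y‖ * ‖y‖) ≤ M.entrySum * (‖x - y‖ * R) :=
    mul_le_mul_of_nonneg_left (mul_le_mul_of_nonneg_left hy (norm_nonneg _)) M.entrySum_nonneg
  linarith

/-- Test vectors on which a Hermitian form determines its matrix by polarization. -/
noncomputable def polarVec {n : ℕ} (p : Fin n × Fin n × Bool) : Fin n → ℂ :=
  Pi.single p.1 1 + Pi.single p.2.1 (if p.2.2 then 1 else Complex.I)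

/-- The cross terms are `M i j * c` and its conjugate, so `c = 1` isolates the real part of `M i j`
and `c = I` minus its imaginary part. -/
lemma Matrix.halfForm_polarVec {n : ℕ} {M : Matrix (Fin n) (Fin n) ℂ} (hM : M.IsHermitian)
    (i j : Fin n) (c : ℂ) :
    M.halfForm (Pi.single i 1 + Pi.single j c) =
      (1 / 2) * (M i i).re + (1 / 2) * ‖c‖ ^ 2 * (M j j).re + (M i j * c).re := by
  have hji : M j i = star (M i j) := (hM.apply j i).symm
  have h : star (Pi.single i 1 + Pi.single j c) ⬝ᵥ (M *ᵥ (Pi.single i 1 + Pi.single j c)) =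
      M i i + star c * c * M j j + (M i j * c + star (M i j * c)) := by
    simp only [star_add, add_dotProduct, mulVec_add, dotProduct_add, Pi.star_single,
      single_dotProduct, mulVec_single, star_one, col_apply, Pi.smul_apply,
      MulOpposite.smul_eq_mul_unop, MulOpposite.unop_op, hji, star_mul']
    ring
  rw [Matrix.halfForm, h]
  have h2 : star c * c = ((‖c‖ ^ 2 : ℝ) : ℂ) := by
    rw [Complex.star_def, ← Complex.normSq_eq_conj_mul_self, Complex.normSq_eq_norm_sq]
  rw [h2, Complex.add_re, Complex.add_re, Complex.add_re, Complex.re_ofReal_mul, Complex.star_def,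
    Complex.conj_re]
  ring

/-- The sum of the absolute values of a quadratic form at the test vectors. -/
noncomputable def Matrix.polarSum {n : ℕ} (M : Matrix (Fin n) (Fin n) ℂ) : ℝ :=
  ∑ p : Fin n × Fin n × Bool, |M.halfForm (polarVec p)|

lemma Matrix.norm_apply_le_polarSum {n : ℕ} {M : Matrix (Fin n) (Fin n) ℂ} (hM : M.IsHermitian)
    (i j : Fin n) : ‖M i j‖ ≤ 4 * M.polarSum := by
  have key (p) : |M.halfForm (polarVec p)| ≤ M.polarSum :=
    Finset.single_le_sum (f := fun p => |M.halfForm (polarVec p)|) (fun _ _ => abs_nonneg _)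
      (Finset.mem_univ p)
  -- For equal indices the test vector is twice a basis vector and the form is `2 * (M i i).re`.
  -- This controls the diagonal terms to be subtracted from `h1` and `h2`.
  have hi := key (i, i, true)
  have hj := key (j, j, true)
  have h1 := key (i, j, true)
  have h2 := key (i, j, false)
  simp only [polarVec, if_true, Bool.false_eq_true, if_false, M.halfForm_polarVec hM, norm_one,
    Complex.norm_I, mul_one, one_pow, Complex.mul_I_re] at hi hj h1 h2
  rw [abs_le] at hi hj h1 h2
  refine (Complex.norm_le_abs_re_add_abs_im _).trans ?_
  have h3 : |(M i j).re| ≤ 2 * M.polarSum := abs_le.2 ⟨by linarith, by linarith⟩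
  have h4 : |(M i j).im| ≤ 2 * M.polarSum := abs_le.2 ⟨by linarith, by linarith⟩
  linarith

lemma Matrix.entrySum_le_polarSum {n : ℕ} {M : Matrix (Fin n) (Fin n) ℂ} (hM : M.IsHermitian) :
    M.entrySum ≤ n * n * 4 * M.polarSum := by
  refine (Finset.sum_le_sum fun i _ => Finset.sum_le_sum fun j _ =>
    M.norm_apply_le_polarSum hM i j).trans_eq ?_
  simp only [Finset.sum_const, Finset.card_univ, Fintype.card_fin, nsmul_eq_mul]; ring

/-! ### Differentiating the storage function; the KYP block form. -/

lemma hasDerivAt_apply_matrix {k l : ℕ} {Q : ℝ → Matrix (Fin k) (Fin l) ℂ}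
    {Q' : Matrix (Fin k) (Fin l) ℂ} {t : ℝ} (h : HasDerivAt Q Q' t) (i : Fin k) (j : Fin l) :
    HasDerivAt (fun t => Q t i j) (Q' i j) t :=
  hasDerivAt_pi.1 (hasDerivAt_pi.1 h i) j

lemma HasDerivAt.star_dotProduct_mulVec {n : ℕ} {Q : ℝ → Matrix (Fin n) (Fin n) ℂ}
    {Q' : Matrix (Fin n) (Fin n) ℂ} {x : ℝ → Fin n → ℂ} {x' : Fin n → ℂ} {t : ℝ}
    (hQ : HasDerivAt Q Q' t) (hx : HasDerivAt x x' t) :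
    HasDerivAt (fun t => star (x t) ⬝ᵥ (Q t *ᵥ x t))
      (star x' ⬝ᵥ (Q t *ᵥ x t) + star (x t) ⬝ᵥ (Q' *ᵥ x t) + star (x t) ⬝ᵥ (Q t *ᵥ x')) t := by
  have hxi := hasDerivAt_pi.1 hx
  have h : HasDerivAt (fun t => ∑ i, star (x t i) * ∑ j, Q t i j * x t j)
      (∑ i, (star (x' i) * ∑ j, Q t i j * x t j +
        star (x t i) * ∑ j, (Q' i j * x t j + Q t i j * x' j))) t :=
    HasDerivAt.fun_sum fun i _ => (hxi i).star.mul
      (HasDerivAt.fun_sum fun j _ => (hasDerivAt_apply_matrix hQ i j).mul (hxi j))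
  refine h.congr_deriv ?_
  simp only [dotProduct, mulVec, Pi.star_apply, Finset.sum_add_distrib, mul_add, add_assoc]

lemma hasDerivAt_quadStorage {n : ℕ} {Q : ℝ → Matrix (Fin n) (Fin n) ℂ}
    {Q' : Matrix (Fin n) (Fin n) ℂ} {x : ℝ → Fin n → ℂ} {x' : Fin n → ℂ} {t : ℝ}
    (hQ : HasDerivAt Q Q' t) (hx : HasDerivAt x x' t) :
    HasDerivAt (fun t => quadStorage Q t (x t))
      ((1 / 2) * (star x' ⬝ᵥ (Q t *ᵥ x t) + star (x t) ⬝ᵥ (Q' *ᵥ x t) +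
        star (x t) ⬝ᵥ (Q t *ᵥ x')).re) t :=
  (((Complex.reCLM.hasFDerivAt (x := star (x t) ⬝ᵥ (Q t *ᵥ x t))).comp_hasDerivAt t
    (hQ.star_dotProduct_mulVec hx))).const_mul (1 / 2)

lemma hasDerivAt_quadStorage_const {n : ℕ} {Q : ℝ → Matrix (Fin n) (Fin n) ℂ}
    {Q' : Matrix (Fin n) (Fin n) ℂ} {t : ℝ} (hQ : HasDerivAt Q Q' t) (x : Fin n → ℂ) :
    HasDerivAt (fun t => quadStorage Q t x) (Q'.halfForm x) t := by
  have h := hasDerivAt_quadStorage hQ (hasDerivAt_const t x)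
  simpa [Matrix.halfForm] using h

lemma HasDerivAt.isHermitian {n : ℕ} {Q : ℝ → Matrix (Fin n) (Fin n) ℂ}
    {Q' : Matrix (Fin n) (Fin n) ℂ} {t : ℝ} (hQ : HasDerivAt Q Q' t)
    (hH : ∀ᶠ s in nhds t, (Q s).IsHermitian) : Q'.IsHermitian := by
  ext i j
  have h1 := (hasDerivAt_apply_matrix hQ j i).star
  refine h1.unique ((hasDerivAt_apply_matrix hQ i j).congr_of_eventuallyEq ?_)
  filter_upwards [hH] with s hs
  exact hs.apply i j

/-- The block form of the KYP inequality is the supply rate minus the derivative of the storage,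
up to a factor 2. -/
lemma kyp_form_re {n m : ℕ} (A Q Q' : Matrix (Fin n) (Fin n) ℂ) (B : Matrix (Fin n) (Fin m) ℂ)
    (C : Matrix (Fin m) (Fin n) ℂ) (D : Matrix (Fin m) (Fin m) ℂ) (x : Fin n → ℂ)
    (u : Fin m → ℂ) :
    (star (Sum.elim x u) ⬝ᵥ (fromBlocks (-(Aᴴ * Q) - Q * A - Q') (Cᴴ - Q * B)
      (C - Bᴴ * Q) (D + Dᴴ) *ᵥ Sum.elim x u)).re =
    2 * (star (C *ᵥ x + D *ᵥ u) ⬝ᵥ u).re -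
      (star (A *ᵥ x + B *ᵥ u) ⬝ᵥ (Q *ᵥ x) + star x ⬝ᵥ (Q' *ᵥ x) +
        star x ⬝ᵥ (Q *ᵥ (A *ᵥ x + B *ᵥ u))).re := by
  have hadj {k l : ℕ} (M : Matrix (Fin k) (Fin l) ℂ) (v : Fin l → ℂ) (w : Fin k → ℂ) :
      star v ⬝ᵥ (Mᴴ *ᵥ w) = star (M *ᵥ v) ⬝ᵥ w := by
    rw [star_mulVec, dotProduct_mulVec]
  have hre {k : ℕ} (v w : Fin k → ℂ) : (star v ⬝ᵥ w).re = (star w ⬝ᵥ v).re := by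
    rw [← Complex.conj_re (star w ⬝ᵥ v), ← Complex.star_def, star_dotProduct]
  have hstar : star (Sum.elim x u) = Sum.elim (star x) (star u) := by
    ext i; cases i <;> rfl
  have e1 := hre u (C *ᵥ x)
  have e2 := hre u (D *ᵥ u)
  simp only [hstar, fromBlocks_mulVec, Sum.elim_comp_inl, Sum.elim_comp_inr, sumElim_dotProduct_sumElim,
    sub_mulVec, neg_mulVec, add_mulVec, dotProduct_add, dotProduct_sub, dotProduct_neg,
    ← mulVec_mulVec, hadj, star_add, add_dotProduct, mulVec_add, Complex.add_re, Complex.sub_re,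
    Complex.neg_re]
  linarith

/-! ### Sufficiency: from the KYP inequality to dissipation. -/

lemma LTVSystem.Icc_subset {n m : ℕ} (S : LTVSystem n m) {a b : ℝ} (ha : a ∈ S.T) (hb : b ∈ S.T) :
    Set.Icc a b ⊆ S.T := S.ordConnected_T.out ha hb

lemma LTVSystem.uIcc_subset {n m : ℕ} (S : LTVSystem n m) {a b : ℝ} (ha : a ∈ S.T)
    (hb : b ∈ S.T) : Set.uIcc a b ⊆ S.T := S.ordConnected_T.uIcc_subset ha hb

lemma integrableOn_star_dotProduct {k : ℕ} {T K : Set ℝ} {u y : ℝ → Fin k → ℂ}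
    (hu : VectorLpLocOn u 2 T) (hy : VectorLpLocOn y 2 T) (hK : IsCompact K) (hKT : K ⊆ T) :
    IntegrableOn (fun t => star (y t) ⬝ᵥ u t) K :=
  integrable_finsetSum _ fun i _ =>
    (hy i K hK hKT).star.integrable_mul (hu i K hK hKT)

lemma AUCOn.exists_le {f : ℝ → ℝ} {a b : ℝ} (hf : AUCOn f a b) (hab : a ≤ b) :
    ∃ c, ∀ t ∈ Set.Icc a b, f t ≤ c := by
  obtain ⟨g, hg, hle⟩ := hf
  have hgi : IntervalIntegrable g volume a b :=
    (intervalIntegrable_iff_integrableOn_Icc_of_le hab).2 hg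
  refine ⟨f a + ∫ t in a..b, ‖g t‖, fun t ht => ?_⟩
  have h1 := hle a (Set.left_mem_Icc.2 hab) t ht ht.1
  have h2 : ∫ s in a..t, g s ≤ ∫ s in a..t, ‖g s‖ :=
    (Real.le_norm_self _).trans (intervalIntegral.norm_integral_le_integral_norm ht.1)
  have h3 : ∫ s in a..t, ‖g s‖ ≤ ∫ s in a..b, ‖g s‖ :=
    intervalIntegral.integral_mono_interval le_rfl ht.1 ht.2
      (Filter.Eventually.of_forall fun _ => norm_nonneg _) hgi.norm
  linarith

/-- A locally absolutely upper semicontinuous, positive semidefinite matrix function is bounded on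
compact intervals. -/
lemma MatrixAUCLocOn.exists_entrySum_le {n : ℕ} {Q : ℝ → Matrix (Fin n) (Fin n) ℂ} {T : Set ℝ}
    (hT : T.OrdConnected) (hQ : MatrixAUCLocOn Q T) (hpos : ∀ t ∈ T, ∀ x, 0 ≤ (Q t).halfForm x)
    {a b : ℝ} (ha : a ∈ T) (hb : b ∈ T) (hab : a ≤ b) :
    ∃ c, 0 ≤ c ∧ ∀ t ∈ Set.Icc a b, (Q t).entrySum ≤ c := by
  choose c hc using fun p => (hQ.2 a ha b hb hab (polarVec (n := n) p)).exists_le hab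
  have h : ∀ t ∈ Set.Icc a b, (Q t).entrySum ≤ n * n * 4 * ∑ p, c p := fun t ht => by
    have htT := hT.out ha hb ht
    refine (Matrix.entrySum_le_polarSum (hQ.1 t htT)).trans ?_
    gcongr
    refine Finset.sum_le_sum fun p _ => ?_
    -- Positivity turns the one-sided bound into a bound on the absolute value.
    rw [abs_of_nonneg (hpos t htT _)]
    exact hc p t ht
  exact ⟨_, (Matrix.entrySum_nonneg _).trans (h a (Set.left_mem_Icc.2 hab)), h⟩

/-- A locally absolutely upper semicontinuous matrix function that is differentiable almost
everywhere has an integrable majorant of its increments that is uniform in the vector. -/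
lemma MatrixAUCLocOn.exists_uniform_majorant {n : ℕ} {Q : ℝ → Matrix (Fin n) (Fin n) ℂ}
    {T : Set ℝ} (hTo : IsOpen T) (hT : T.OrdConnected) (hQ : MatrixAUCLocOn Q T)
    (hd : ∀ᵐ t ∂(volume.restrict T), ∃ Q', HasDerivAt Q Q' t)
    {a b : ℝ} (ha : a ∈ T) (hb : b ∈ T) (hab : a ≤ b) :
    ∃ g : ℝ → ℝ, IntegrableOn g (Set.Icc a b) ∧ (∀ t, 0 ≤ g t) ∧
      ∀ r ∈ Set.Icc a b, ∀ s ∈ Set.Icc a b, r ≤ s → ∀ x,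
        quadStorage Q s x - quadStorage Q r x ≤ ‖x‖ ^ 2 * ∫ t in r..s, g t := by
  have hint (p) : IntegrableOn (deriv fun t => quadStorage Q t (polarVec p)) (Set.Icc a b) :=
    (intervalIntegrable_iff_integrableOn_Icc_of_le hab).1
      ((hQ.2 a ha b hb hab (polarVec p)).deriv_spec hab).2.1
  -- Where `Q` has a derivative `Q'`, this majorant is `n * n * 4 * Q'.polarSum`, which dominates
  -- `Q'.entrySum`.
  have hgint : IntegrableOn (fun t => (n * n * 4 : ℝ) * ∑ p,
      |deriv (fun t => quadStorage Q t (polarVec p)) t|) (Set.Icc a b) :=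
    (integrable_finsetSum _ fun p _ => (hint p).abs).const_mul _
  refine ⟨_, hgint, fun t => by positivity, fun r hr s hs hrs x => ?_⟩
  have hsub : Set.Icc r s ⊆ Set.Icc a b := Set.Icc_subset_Icc hr.1 hs.2
  -- The given majorant depends on `x`; it is replaced by the derivative itself, which is
  -- `Q'.halfForm x` almost everywhere.
  obtain ⟨-, hdi, hle⟩ := ((hQ.2 a ha b hb hab x).mono hsub).deriv_spec hrs
  refine hle.trans ?_
  rw [← intervalIntegral.integral_const_mul]
  refine intervalIntegral.integral_mono_ae_restrict hrs hdi
    (((intervalIntegrable_iff_integrableOn_Icc_of_le hrs).2 (hgint.mono_set hsub)).const_mul _) ?_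
  have hsubT : Set.Icc r s ⊆ T := hsub.trans (hT.out ha hb)
  filter_upwards [ae_restrict_of_ae_restrict_of_subset hsubT hd,
    ae_restrict_mem measurableSet_Icc] with t ⟨Q', hQ'⟩ ht
  have hH : Q'.IsHermitian := hQ'.isHermitian <| by
    filter_upwards [hTo.mem_nhds (hsubT ht)] with s hs using hQ.1 s hs
  have hq (x) : deriv (fun t => quadStorage Q t x) t = Q'.halfForm x :=
    (hasDerivAt_quadStorage_const hQ' x).deriv
  simp only [hq]
  calc Q'.halfForm x ≤ |Q'.halfForm x| := le_abs_self _
    _ ≤ Q'.entrySum * ‖x‖ ^ 2 := Q'.abs_halfForm_le x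
    _ ≤ (n * n * 4 * Q'.polarSum) * ‖x‖ ^ 2 := by
      gcongr; exact Matrix.entrySum_le_polarSum hH
    _ = _ := by rw [mul_comm]; rfl

/-- The increment is split at `quadStorage Q s (x r)`. Moving the vector costs a Lipschitz term
because `Q` is bounded; moving the time uses the majorant, whose uniformity is essential since the
vector `x r` varies with `r`. -/
lemma MatrixAUCLocOn.aucOn_quadStorage_comp {n : ℕ} {Q : ℝ → Matrix (Fin n) (Fin n) ℂ}
    {T : Set ℝ} (hTo : IsOpen T) (hT : T.OrdConnected) (hQ : MatrixAUCLocOn Q T)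
    (hpos : ∀ t ∈ T, ∀ x, 0 ≤ (Q t).halfForm x)
    (hd : ∀ᵐ t ∂(volume.restrict T), ∃ Q', HasDerivAt Q Q' t)
    {a b : ℝ} (ha : a ∈ T) (hb : b ∈ T) (hab : a ≤ b) {x : ℝ → Fin n → ℂ}
    (hx : AbsolutelyContinuousOnInterval x a b) :
    AUCOn (fun t => quadStorage Q t (x t)) a b := by
  obtain ⟨c, hc0, hc⟩ := hQ.exists_entrySum_le hT hpos ha hb hab
  obtain ⟨g, hg, hg0, hgle⟩ := hQ.exists_uniform_majorant hTo hT hd ha hb hab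
  obtain ⟨g', hg', hgle'⟩ := hx.exists_norm_sub_le_integral hab
  obtain ⟨R, hR⟩ := hx.exists_bound
  rw [Set.uIcc_of_le hab] at hR
  have hR0 : 0 ≤ R := (norm_nonneg _).trans (hR a (Set.left_mem_Icc.2 hab))
  refine ⟨fun t => c * R * g' t + R ^ 2 * g t, 
    Integrable.fun_add (hg'.const_mul (c * R)) (hg.const_mul (R ^ 2)),
    fun r hr s hs hrs => ?_⟩
  have hsub : Set.Icc r s ⊆ Set.Icc a b := Set.Icc_subset_Icc hr.1 hs.2
  have hi {g : ℝ → ℝ} (hg : IntegrableOn g (Set.Icc a b)) : IntervalIntegrable g volume r s :=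
    (intervalIntegrable_iff_integrableOn_Icc_of_le hrs).2 (hg.mono_set hsub)
  rw [intervalIntegral.integral_add ((hi hg').const_mul _) ((hi hg).const_mul _),
    intervalIntegral.integral_const_mul, intervalIntegral.integral_const_mul]
  have h1 : quadStorage Q s (x s) - quadStorage Q s (x r) ≤ c * R * ∫ t in r..s, g' t := by
    refine ((Q s).halfForm_sub_le (hR s hs) (hR r hr)).trans ?_
    exact mul_le_mul (mul_le_mul_of_nonneg_right (hc s hs) hR0) (hgle' r hr s hs hrs)
      (norm_nonneg _) (mul_nonneg hc0 hR0)
  have h2 : quadStorage Q s (x r) - quadStorage Q r (x r) ≤ R ^ 2 * ∫ t in r..s, g t := by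
    refine (hgle r hr s hs hrs (x r)).trans ?_
    have := intervalIntegral.integral_nonneg (f := g) (μ := volume) hrs fun t _ => hg0 t
    have := hR r hr
    gcongr
  linarith

lemma Matrix.PosSemidef.halfForm_nonneg {n : ℕ} {M : Matrix (Fin n) (Fin n) ℂ}
    (hM : M.PosSemidef) (x : Fin n → ℂ) : 0 ≤ M.halfForm x :=
  mul_nonneg (by norm_num) (Complex.le_def.1 (hM.dotProduct_mulVec_nonneg x)).1

theorem LTVSystem.SolvesKYP.isStorageFunction {n m : ℕ} {S : LTVSystem n m}
    {Q : ℝ → Matrix (Fin n) (Fin n) ℂ} (hK : S.SolvesKYP Q)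
    (hQ : ∀ t ∈ S.T, (Q t).PosSemidef) (hauc : MatrixAUCLocOn Q S.T) :
    S.IsStorageFunction (quadStorage Q) where
  nonneg t ht x := (hQ t ht).halfForm_nonneg x
  zero t _ := by simp [quadStorage]
  dissipation x u y hsol t₀ ht₀ t₁ ht₁ h01 := by
    have hd : ∀ᵐ t ∂(volume.restrict S.T), ∃ Q', HasDerivAt Q Q' t :=
      hK.mono fun t ⟨Q', h, _⟩ => ⟨Q', h⟩
    have hA := hauc.aucOn_quadStorage_comp S.isOpen_T S.ordConnected_T
      (fun t ht x => (hQ t ht).halfForm_nonneg x) hd ht₀ ht₁ h01 (hsol.state_mem t₀ ht₀ t₁ ht₁)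
    obtain ⟨-, hdi, hle⟩ := hA.deriv_spec h01
    have hsub := S.Icc_subset ht₀ ht₁
    refine hle.trans (intervalIntegral.integral_mono_ae_restrict h01 hdi
      ((intervalIntegrable_iff_integrableOn_Icc_of_le h01).2
        (integrableOn_star_dotProduct hsol.input_mem hsol.output_mem isCompact_Icc hsub).re) ?_)
    filter_upwards [ae_restrict_of_ae_restrict_of_subset hsub hK,
      ae_restrict_of_ae_restrict_of_subset hsub hsol.state_eq,
      ae_restrict_of_ae_restrict_of_subset hsub hsol.output_eq] with t ⟨Q', hQ', hpsd⟩ hx hy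
    rw [(hasDerivAt_quadStorage hQ' hx).deriv, hy]
    have h := (Complex.le_def.1 (hpsd.dotProduct_mulVec_nonneg (Sum.elim (x t) (u t)))).1
    rw [kyp_form_re] at h
    change _ ≤ (star (S.C t *ᵥ x t + S.D t *ᵥ u t) ⬝ᵥ u t).re
    rw [Complex.zero_re] at h
    linarith

/-! ### Linear integral equations and the Peano-Baker series. -/

section LinearODE

variable {T : Set ℝ} {E : Type*} [NormedAddCommGroup E] [NormedSpace ℝ E]

lemma exists_Icc_mem_nhds_of_isOpen (hTo : IsOpen T) {t₀ t : ℝ} (ht₀ : t₀ ∈ T) (ht : t ∈ T) :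
    ∃ a ∈ T, ∃ b ∈ T, Set.Icc a b ∈ nhds t ∧ t₀ ∈ Set.Icc a b := by
  obtain ⟨ε, hε, hball⟩ := Metric.isOpen_iff.1 hTo t ht
  have h1 : t - ε / 2 ∈ T := hball <| by
    rw [Metric.mem_ball, Real.dist_eq, abs_lt]; constructor <;> linarith
  have h2 : t + ε / 2 ∈ T := hball <| by
    rw [Metric.mem_ball, Real.dist_eq, abs_lt]; constructor <;> linarith
  refine ⟨min (t - ε / 2) t₀, ?_, max (t + ε / 2) t₀, ?_, Icc_mem_nhds ?_ ?_, ?_⟩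
  · rcases min_choice (t - ε / 2) t₀ with h | h <;> rw [h] <;> assumption
  · rcases max_choice (t + ε / 2) t₀ with h | h <;> rw [h] <;> assumption
  · exact (min_le_left _ _).trans_lt (by linarith)
  · exact lt_of_lt_of_le (by linarith) (le_max_left _ _)
  · exact ⟨min_le_right _ _, le_max_right _ _⟩

lemma continuousOn_primitive_of_isOpen (hTo : IsOpen T) {f : ℝ → E}
    (hf : ∀ a ∈ T, ∀ b ∈ T, IntervalIntegrable f volume a b) {t₀ : ℝ} (ht₀ : t₀ ∈ T) :
    ContinuousOn (fun t => ∫ s in t₀..t, f s) T := by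
  intro t ht
  obtain ⟨a, ha, b, hb, hab, h0⟩ := exists_Icc_mem_nhds_of_isOpen hTo ht₀ ht
  have hle : a ≤ b := h0.1.trans h0.2
  rw [← Set.uIcc_of_le hle] at hab h0
  exact ((intervalIntegral.continuousOn_primitive_interval' (hf a ha b hb) h0).continuousAt
    hab).continuousWithinAt

lemma AbsolutelyContinuousOnInterval.pow {f : ℝ → ℝ} {a b : ℝ}
    (hf : AbsolutelyContinuousOnInterval f a b) (k : ℕ) :
    AbsolutelyContinuousOnInterval (f ^ k) a b := by
  induction k with
  | zero =>
    rw [pow_zero]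
    exact (LipschitzWith.const (1 : ℝ)).lipschitzOnWith.absolutelyContinuousOnInterval
  | succ k ih => rw [pow_succ]; exact ih.mul hf

/-- The integrand is almost everywhere the derivative of `F ^ (k + 1) / (k + 1)` with `F` the
primitive of `f`; `F` is absolutely continuous, so the fundamental theorem applies. Iteration of
this formula produces the factorials in `norm_peanoBaker_le`. -/
lemma integral_pow_primitive_mul {f : ℝ → ℝ} {a b : ℝ} (hf : IntervalIntegrable f volume a b)
    (k : ℕ) : ∫ t in a..b, (∫ s in a..t, f s) ^ k * f t = (∫ s in a..b, f s) ^ (k + 1) / (k + 1) := by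
  set F : ℝ → ℝ := fun t => ∫ s in a..t, f s with hF
  have hac : AbsolutelyContinuousOnInterval F a b :=
    hf.absolutelyContinuousOnInterval_intervalIntegral Set.left_mem_uIcc
  have h := (hac.pow (k + 1)).integral_deriv_eq_sub
  have h2 : ∫ t in a..b, deriv (F ^ (k + 1)) t = ∫ t in a..b, (k + 1 : ℝ) * (F t ^ k * f t) := by
    refine intervalIntegral.integral_congr_ae ?_
    filter_upwards [hf.ae_hasDerivAt_integral] with t ht htm
    have h3 := (ht (Set.uIoc_subset_uIcc htm) a Set.left_mem_uIcc).pow (k + 1)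
    rw [h3.deriv]
    push_cast
    simp only [hF]
    ring
  rw [h2, intervalIntegral.integral_const_mul] at h
  rw [eq_div_iff (by positivity), mul_comm, h]
  simp only [Pi.pow_apply, hF]
  simp

variable {A : ℝ → E →L[ℝ] E}

lemma intervalIntegrable_clm_apply (hT : T.OrdConnected)
    (hA : ∀ a ∈ T, ∀ b ∈ T, IntervalIntegrable A volume a b) {x : ℝ → E} (hx : ContinuousOn x T)
    {a b : ℝ} (ha : a ∈ T) (hb : b ∈ T) : IntervalIntegrable (fun t => A t (x t)) volume a b := by
  have hsub := hT.uIcc_subset ha hb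
  obtain ⟨C, hC⟩ := isCompact_uIcc.exists_bound_of_continuousOn (hx.mono hsub)
  have hAi := hA a ha b hb
  rw [intervalIntegrable_iff] at hAi ⊢
  have hxm : AEStronglyMeasurable x (volume.restrict (Set.uIoc a b)) :=
    (hx.mono (Set.uIoc_subset_uIcc.trans hsub)).aestronglyMeasurable measurableSet_uIoc
  refine (hAi.norm.mul_const C).mono'
    (isBoundedBilinearMap_apply.continuous.comp_aestronglyMeasurable (hAi.1.prodMk hxm)) ?_
  filter_upwards [ae_restrict_mem measurableSet_uIoc] with t ht
  exact (A t).le_opNorm_of_le (hC t (Set.uIoc_subset_uIcc ht))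

/-- The terms of the Peano-Baker series. -/
noncomputable def peanoBaker (A : ℝ → E →L[ℝ] E) (f : ℝ → E) (t₀ : ℝ) : ℕ → ℝ → E
  | 0 => f
  | k + 1 => fun t => ∫ s in t₀..t, A s (peanoBaker A f t₀ k s)

variable {f : ℝ → E} {t₀ : ℝ}

lemma continuousOn_peanoBaker (hTo : IsOpen T) (hT : T.OrdConnected)
    (hA : ∀ a ∈ T, ∀ b ∈ T, IntervalIntegrable A volume a b) (hf : ContinuousOn f T)
    (ht₀ : t₀ ∈ T) (k : ℕ) : ContinuousOn (peanoBaker A f t₀ k) T := by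
  induction k with
  | zero => exact hf
  | succ k ih =>
    exact continuousOn_primitive_of_isOpen hTo
      (fun a ha b hb => intervalIntegrable_clm_apply hT hA ih ha hb) ht₀

lemma norm_peanoBaker_le {a b M : ℝ} (hab : a ≤ b) (hA : IntervalIntegrable A volume a b)
    (ht₀ : t₀ ∈ Set.Icc a b) (hM : ∀ t ∈ Set.Icc a b, ‖f t‖ ≤ M) (k : ℕ) :
    ∀ t ∈ Set.Icc a b,
      ‖peanoBaker A f t₀ k t‖ ≤ M * |∫ s in t₀..t, ‖A s‖| ^ k / k.factorial := by
  have hM0 : 0 ≤ M := (norm_nonneg _).trans (hM t₀ ht₀)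
  induction k with
  | zero => simpa [peanoBaker] using hM
  | succ k ih =>
    intro t ht
    have hsub : Set.uIcc t₀ t ⊆ Set.uIcc a b := by
      rw [Set.uIcc_of_le hab]; exact Set.uIcc_subset_Icc ht₀ ht
    have hAi : IntervalIntegrable (fun s => ‖A s‖) volume t₀ t := (hA.mono_set hsub).norm
    have hc : ContinuousOn (fun s => M * (∫ r in t₀..s, ‖A r‖) ^ k / k.factorial)
        (Set.uIcc t₀ t) :=
      ((continuousOn_const.mul ((intervalIntegral.continuousOn_primitive_interval' hAi
        Set.left_mem_uIcc).pow k)).div_const _)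
    have hi := hAi.mul_continuousOn hc.norm
    have hle : ‖peanoBaker A f t₀ (k + 1) t‖ ≤
        |∫ s in t₀..t, ‖A s‖ * ‖M * (∫ r in t₀..s, ‖A r‖) ^ k / k.factorial‖| := by
      refine intervalIntegral.norm_integral_le_abs_of_norm_le ?_ hi
      filter_upwards [ae_restrict_mem measurableSet_uIoc] with s hs
      have hsab : s ∈ Set.Icc a b := by
        have := hsub (Set.uIoc_subset_uIcc hs); rwa [Set.uIcc_of_le hab] at this
      refine (A s).le_opNorm_of_le ((ih s hsab).trans_eq ?_)
      rw [norm_div, norm_mul, norm_pow, Real.norm_of_nonneg hM0, Real.norm_eq_abs,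
        Real.norm_natCast]
    refine hle.trans_eq ?_
    -- On either side of `t₀` the primitive has constant sign `ε`, so the absolute value leaves the
    -- integral as the constant factor `ε ^ k`.
    have hsign : ∃ ε : ℝ, |ε| = 1 ∧ ∀ s ∈ Set.uIcc t₀ t, |∫ r in t₀..s, ‖A r‖| =
        ε * ∫ r in t₀..s, ‖A r‖ := by
      rcases le_total t₀ t with h | h
      · refine ⟨1, by simp, fun s hs => ?_⟩
        rw [Set.uIcc_of_le h] at hs
        rw [one_mul, abs_of_nonneg (intervalIntegral.integral_nonneg hs.1 fun _ _ => norm_nonneg _)]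
      · refine ⟨-1, by simp, fun s hs => ?_⟩
        rw [Set.uIcc_of_ge h] at hs
        rw [intervalIntegral.integral_symm, abs_neg, mul_neg, neg_mul, neg_neg, one_mul,
          abs_of_nonneg (intervalIntegral.integral_nonneg hs.2 fun _ _ => norm_nonneg _)]
    obtain ⟨ε, hε, hsgn⟩ := hsign
    have hcongr : ∫ s in t₀..t, ‖A s‖ * ‖M * (∫ r in t₀..s, ‖A r‖) ^ k / k.factorial‖ =
        ∫ s in t₀..t, (M * ε ^ k / k.factorial) * ((∫ r in t₀..s, ‖A r‖) ^ k * ‖A s‖) := by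
      refine intervalIntegral.integral_congr fun s hs => ?_
      rw [norm_div, norm_mul, norm_pow, Real.norm_of_nonneg hM0, Real.norm_eq_abs,
        Real.norm_natCast, hsgn s hs]
      ring
    rw [hcongr, intervalIntegral.integral_const_mul, integral_pow_primitive_mul hAi, abs_mul,
      abs_div, abs_div, abs_mul, abs_pow, abs_pow, hε, abs_of_nonneg hM0, Nat.abs_cast,
      abs_of_pos (by positivity : (0 : ℝ) < k + 1), Nat.factorial_succ]
    push_cast
    rw [one_pow, mul_one]
    field_simp

variable [CompleteSpace E]

/-- Existence of Carathéodory solutions of linear integral equations with locally integrable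
coefficients. -/
theorem exists_linear_integral_equation (hTo : IsOpen T) (hT : T.OrdConnected)
    (hA : ∀ a ∈ T, ∀ b ∈ T, IntervalIntegrable A volume a b) (hf : ContinuousOn f T)
    (ht₀ : t₀ ∈ T) :
    ∃ x : ℝ → E, ContinuousOn x T ∧ ∀ t ∈ T, x t = f t + ∫ s in t₀..t, A s (x s) := by
  -- Weierstrass majorant: the terms of an exponential series in `∫ ‖A‖` over a compact interval.
  have hbound : ∀ a ∈ T, ∀ b ∈ T, t₀ ∈ Set.Icc a b → ∃ c : ℕ → ℝ, Summable c ∧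
      ∀ k, ∀ t ∈ Set.Icc a b, ‖peanoBaker A f t₀ k t‖ ≤ c k := by
    intro a ha b hb h0
    have hab : a ≤ b := h0.1.trans h0.2
    obtain ⟨M, hM⟩ := isCompact_Icc.exists_bound_of_continuousOn (hf.mono (hT.out ha hb))
    have hM0 : 0 ≤ M := (norm_nonneg _).trans (hM t₀ h0)
    refine ⟨fun k => M * ((∫ s in a..b, ‖A s‖) ^ k / k.factorial),
      (Real.summable_pow_div_factorial _).mul_left M, fun k t ht => ?_⟩
    refine (norm_peanoBaker_le hab (hA a ha b hb) h0 hM k t ht).trans ?_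
    rw [mul_div_assoc]
    have : |∫ s in t₀..t, ‖A s‖| ≤ ∫ s in a..b, ‖A s‖ := by
      refine (intervalIntegral.abs_integral_mono_interval (c := a) (d := b) ?_
        (Filter.Eventually.of_forall fun _ => norm_nonneg _) (hA a ha b hb).norm).trans_eq
        (abs_of_nonneg (intervalIntegral.integral_nonneg hab fun _ _ => norm_nonneg _))
      rw [Set.uIoc_of_le hab]
      exact Set.Ioc_subset_Ioc (le_min h0.1 ht.1) (max_le h0.2 ht.2)
    exact mul_le_mul_of_nonneg_left (div_le_div_of_nonneg_right
      (pow_le_pow_left₀ (abs_nonneg _) this k) (by positivity)) hM0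
  set X := peanoBaker A f t₀ with hX
  have hXc := continuousOn_peanoBaker hTo hT hA hf ht₀
  have hsum : ∀ t ∈ T, Summable fun k => X k t := fun t ht => by
    obtain ⟨a, ha, b, hb, hab, h0⟩ := exists_Icc_mem_nhds_of_isOpen hTo ht₀ ht
    obtain ⟨c, hc, hle⟩ := hbound a ha b hb h0
    exact Summable.of_norm_bounded hc fun k => hle k t (mem_of_mem_nhds hab)
  have hxc : ContinuousOn (fun t => ∑' k, X k t) T := fun t ht => by
    obtain ⟨a, ha, b, hb, hab, h0⟩ := exists_Icc_mem_nhds_of_isOpen hTo ht₀ ht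
    obtain ⟨c, hc, hle⟩ := hbound a ha b hb h0
    exact ((continuousOn_tsum (fun k => (hXc k).mono (hT.out ha hb)) hc hle).continuousAt
      hab).continuousWithinAt
  refine ⟨_, hxc, fun t ht => ?_⟩
  obtain ⟨a, ha, b, hb, hab, h0⟩ := exists_Icc_mem_nhds_of_isOpen hTo ht₀ ht
  obtain ⟨c, hc, hle⟩ := hbound a ha b hb h0
  have hsub : Set.uIoc t₀ t ⊆ Set.Icc a b :=
    Set.uIoc_subset_uIcc.trans (Set.uIcc_subset_Icc h0 (mem_of_mem_nhds hab))
  have hswap : HasSum (fun k => ∫ s in t₀..t, A s (X k s)) (∫ s in t₀..t, A s (∑' k, X k s)) := by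
    refine intervalIntegral.hasSum_integral_of_dominated_convergence (fun k s => ‖A s‖ * c k)
      (fun k => (intervalIntegrable_iff.1
        (intervalIntegrable_clm_apply hT hA (hXc k) ht₀ ht)).aestronglyMeasurable)
      (fun k => Filter.Eventually.of_forall fun s hs => (A s).le_opNorm_of_le (hle k s (hsub hs)))
      (Filter.Eventually.of_forall fun s _ => hc.mul_left _) ?_
      (Filter.Eventually.of_forall fun s hs =>
        (hsum s (hT.out ha hb (hsub hs))).hasSum.mapL (A s))
    simp only [tsum_mul_left]
    exact (hA t₀ ht₀ t ht).norm.mul_const _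
  -- The term of index `0` is `f`, and by definition each later term is the integral of `A` applied
  -- to its predecessor.
  rw [(hsum t ht).tsum_eq_zero_add, ← hswap.tsum_eq]
  rfl

end LinearODE

/-! ### Solutions with constant input and their linear combinations. -/

section Solutions

variable {n m : ℕ}

lemma isFiniteMeasure_restrict_of_isCompact {K : Set ℝ} (hK : IsCompact K) :
    IsFiniteMeasure ((volume : Measure ℝ).restrict K) :=
  ⟨by rw [Measure.restrict_apply_univ]; exact hK.measure_lt_top⟩

lemma LpLocOn.integrableOn {f : ℝ → ℂ} {p : ℝ≥0∞} {T K : Set ℝ} (hf : LpLocOn f p T) (hp : 1 ≤ p)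
    (hK : IsCompact K) (hKT : K ⊆ T) : IntegrableOn f K :=
  have := isFiniteMeasure_restrict_of_isCompact hK
  (hf K hK hKT).integrable hp

lemma LTVSystem.intervalIntegrable_of_forall (S : LTVSystem n m) {F : Type*}
    [NormedAddCommGroup F] {f : ℝ → F} (hf : ∀ K, IsCompact K → K ⊆ S.T → IntegrableOn f K)
    {a b : ℝ} (ha : a ∈ S.T) (hb : b ∈ S.T) : IntervalIntegrable f volume a b :=
  intervalIntegrable_iff.2
    ((hf _ isCompact_uIcc (S.uIcc_subset ha hb)).mono_set Set.uIoc_subset_uIcc)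

/-- Multiplication by a complex matrix as a real continuous linear map. -/
noncomputable def Matrix.mulVecCLM (M : Matrix (Fin n) (Fin n) ℂ) :
    (Fin n → ℂ) →L[ℝ] (Fin n → ℂ) :=
  LinearMap.toContinuousLinearMap (M.mulVecLin.restrictScalars ℝ)

lemma integrableOn_mulVecCLM {A : ℝ → Matrix (Fin n) (Fin n) ℂ} {K : Set ℝ}
    (hA : ∀ i j, IntegrableOn (fun t => A t i j) K) :
    IntegrableOn (fun t => (A t).mulVecCLM) K := by
  let L : (Fin n → Fin n → ℂ) →ₗ[ℝ] ((Fin n → ℂ) →L[ℝ] (Fin n → ℂ)) :=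
    { toFun := fun M => Matrix.mulVecCLM (Matrix.of M)
      map_add' := fun M N => by
        ext1 v; exact add_mulVec (Matrix.of M) (Matrix.of N) v
      map_smul' := fun c M => by
        ext1 v; exact smul_mulVec c (Matrix.of M) v }
  have h : Integrable (fun t => (fun i j => A t i j : Fin n → Fin n → ℂ)) (volume.restrict K) :=
    Integrable.of_eval fun i => Integrable.of_eval fun j => hA i j
  exact L.toContinuousLinearMap.integrable_comp h

/-- The increments of `x` are dominated by those of the primitive of `‖φ‖`. -/
lemma LTVSystem.w11LocOn_of_integral (S : LTVSystem n m) {k : ℕ} {x φ : ℝ → Fin k → ℂ} {t₀ : ℝ}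
    {x₀ : Fin k → ℂ} (ht₀ : t₀ ∈ S.T)
    (hφ : ∀ a ∈ S.T, ∀ b ∈ S.T, IntervalIntegrable φ volume a b)
    (hx : ∀ t ∈ S.T, x t = x₀ + ∫ s in t₀..t, φ s) : W11LocOn x S.T := by
  intro a ha b hb
  refine ((hφ a ha b hb).norm.absolutelyContinuousOnInterval_intervalIntegral
    Set.left_mem_uIcc).of_dist_le fun s hs t ht => ?_
  have hsT := S.uIcc_subset ha hb hs
  have htT := S.uIcc_subset ha hb ht
  rw [dist_eq_norm, dist_eq_norm, hx s hsT, hx t htT, add_sub_add_left_eq_sub,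
    intervalIntegral.integral_interval_sub_left (hφ _ ht₀ _ hsT) (hφ _ ht₀ _ htT),
    intervalIntegral.integral_interval_sub_left (hφ _ ha _ hsT).norm (hφ _ ha _ htT).norm]
  exact intervalIntegral.norm_integral_le_abs_integral_norm

lemma LTVSystem.ae_hasDerivAt_integral (S : LTVSystem n m) {F : Type*} [NormedAddCommGroup F]
    [NormedSpace ℝ F] [CompleteSpace F] {φ : ℝ → F} {t₀ : ℝ} (ht₀ : t₀ ∈ S.T)
    (hφ : ∀ a ∈ S.T, ∀ b ∈ S.T, IntervalIntegrable φ volume a b) :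
    ∀ᵐ t ∂(volume.restrict S.T), HasDerivAt (fun t => ∫ s in t₀..t, φ s) (φ t) t := by
  refine ae_restrict_of_forall_Icc S.isOpen_T fun a ha b hb hsub hab => ?_
  have hne : ∀ᵐ t, t ≠ a ∧ t ≠ b := by
    rw [Filter.eventually_and]
    constructor <;> simp [ae_iff, measure_singleton]
  filter_upwards [(hφ a ha b hb).ae_hasDerivAt_integral, hne] with t ht hne htab
  have h1 : HasDerivAt (fun t => (∫ s in t₀..a, φ s) + ∫ s in a..t, φ s) (φ t) t :=
    (ht (by rwa [Set.uIcc_of_le hab.le]) a Set.left_mem_uIcc).const_add _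
  refine h1.congr_of_eventuallyEq ?_
  filter_upwards [S.isOpen_T.mem_nhds (hsub htab)] with s hs
  exact (intervalIntegral.integral_add_adjacent_intervals (hφ _ ht₀ _ ha) (hφ _ ha _ hs)).symm

lemma W11LocOn.continuousOn {k : ℕ} {x : ℝ → Fin k → ℂ} {T : Set ℝ} (hTo : IsOpen T)
    (hx : W11LocOn x T) : ContinuousOn x T := by
  intro t ht
  obtain ⟨a, ha, b, hb, hab, h0⟩ := exists_Icc_mem_nhds_of_isOpen hTo ht ht
  have hc := (hx a ha b hb).continuousOn
  rw [Set.uIcc_of_le (h0.1.trans h0.2)] at hc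
  exact (hc.continuousAt hab).continuousWithinAt

/-- On a compact set `x` is bounded, so `C x` is in `L²`; there the bounded `D` is in `L²` as well,
the measure being finite. -/
lemma LTVSystem.vectorLpLocOn_output (S : LTVSystem n m) {x : ℝ → Fin n → ℂ}
    (hx : ContinuousOn x S.T) (v : Fin m → ℂ) :
    VectorLpLocOn (fun t => S.C t *ᵥ x t + S.D t *ᵥ v) 2 S.T := by
  intro i K hK hKT
  have := isFiniteMeasure_restrict_of_isCompact hK
  have hxj (j : Fin n) : MemLp (fun t => x t j) ∞ (volume.restrict K) := by
    have hc : ContinuousOn (fun t => x t j) K := (continuous_apply j).comp_continuousOn (hx.mono hKT)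
    obtain ⟨c, hcb⟩ := hK.exists_bound_of_continuousOn hc
    exact memLp_top_of_bound (hc.aestronglyMeasurable hK.measurableSet) c
      ((ae_restrict_mem hK.measurableSet).mono hcb)
  have h1 : MemLp (fun t => ∑ j, S.C t i j * x t j) 2 (volume.restrict K) :=
    memLp_finsetSum _ fun j _ => (hxj j).mul (S.C_mem i j K hK hKT)
  have h2 : MemLp (fun t => ∑ j, S.D t i j * v j) 2 (volume.restrict K) :=
    memLp_finsetSum _ fun j _ => ((S.D_mem i j K hK hKT).mono_exponent le_top).mul_const _
  exact h1.add h2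

/-- The initial value problem with a constant input is solvable on the whole time interval. -/
theorem LTVSystem.exists_isSolution_const (S : LTVSystem n m) {t₀ : ℝ} (ht₀ : t₀ ∈ S.T)
    (x₀ : Fin n → ℂ) (v : Fin m → ℂ) :
    ∃ x : ℝ → Fin n → ℂ,
      S.IsSolution x (fun _ => v) (fun t => S.C t *ᵥ x t + S.D t *ᵥ v) ∧ x t₀ = x₀ := by
  have hA : ∀ a ∈ S.T, ∀ b ∈ S.T, IntervalIntegrable (fun t => (S.A t).mulVecCLM) volume a b :=
    fun a ha b hb => S.intervalIntegrable_of_forall (fun K hK hKT =>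
      integrableOn_mulVecCLM fun i j => (S.A_mem i j).integrableOn le_rfl hK hKT) ha hb
  have hB : ∀ a ∈ S.T, ∀ b ∈ S.T, IntervalIntegrable (fun t => S.B t *ᵥ v) volume a b :=
    fun a ha b hb => S.intervalIntegrable_of_forall (fun K hK hKT =>
      Integrable.of_eval fun i => integrable_finsetSum Finset.univ fun j _ =>
        ((S.B_mem i j).integrableOn (by norm_num) hK hKT).mul_const (v j)) ha hb
  obtain ⟨x, hxc, hx⟩ := exists_linear_integral_equation S.isOpen_T S.ordConnected_T hA
    (f := fun t => x₀ + ∫ s in t₀..t, S.B s *ᵥ v)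
    (continuousOn_const.add (continuousOn_primitive_of_isOpen S.isOpen_T hB ht₀)) ht₀
  have hAx : ∀ a ∈ S.T, ∀ b ∈ S.T,
      IntervalIntegrable (fun t => S.A t *ᵥ x t) volume a b := fun a ha b hb =>
    intervalIntegrable_clm_apply S.ordConnected_T hA hxc ha hb
  have hφ : ∀ a ∈ S.T, ∀ b ∈ S.T,
      IntervalIntegrable (fun t => S.A t *ᵥ x t + S.B t *ᵥ v) volume a b :=
    fun a ha b hb => (hAx a ha b hb).add (hB a ha b hb)
  have hxφ : ∀ t ∈ S.T, x t = x₀ + ∫ s in t₀..t, (S.A s *ᵥ x s + S.B s *ᵥ v) := fun t ht => by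
    rw [intervalIntegral.integral_add (hAx _ ht₀ _ ht) (hB _ ht₀ _ ht), hx t ht, add_assoc]
    congr 1
    exact add_comm _ _
  refine ⟨x, ⟨S.w11LocOn_of_integral ht₀ hφ hxφ, fun i K hK _ => ?_,
    S.vectorLpLocOn_output hxc v, ?_, Filter.Eventually.of_forall fun _ => rfl⟩, ?_⟩
  · have := isFiniteMeasure_restrict_of_isCompact hK
    exact memLp_const _
  · filter_upwards [S.ae_hasDerivAt_integral ht₀ hφ, ae_restrict_mem S.isOpen_T.measurableSet]
      with t ht htT
    refine (ht.const_add x₀).congr_of_eventuallyEq ?_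
    filter_upwards [S.isOpen_T.mem_nhds htT] with s hs using hxφ s hs
  · rw [hxφ t₀ ht₀, intervalIntegral.integral_same, add_zero]

variable {ι : Type*} [Fintype ι]

lemma Matrix.mulVec_sum_smul {k l : ℕ} (M : Matrix (Fin k) (Fin l) ℂ) (c : ι → ℂ)
    (v : ι → Fin l → ℂ) : M *ᵥ (∑ i, c i • v i) = ∑ i, c i • (M *ᵥ v i) := by
  simp only [mulVec_sum, mulVec_smul]

lemma HasDerivAt.sum_smul_of_linear {S : LTVSystem n m} {x : ι → ℝ → Fin n → ℂ}
    {v : ι → Fin m → ℂ} {t : ℝ}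
    (h : ∀ i, HasDerivAt (x i) (S.A t *ᵥ x i t + S.B t *ᵥ v i) t) (c : ι → ℂ) :
    HasDerivAt (fun t => ∑ i, c i • x i t)
      (S.A t *ᵥ (∑ i, c i • x i t) + S.B t *ᵥ (∑ i, c i • v i)) t := by
  refine (HasDerivAt.fun_sum fun i _ => (h i).const_smul (c i)).congr_deriv ?_
  simp only [mulVec_sum_smul, smul_add, Finset.sum_add_distrib]

lemma AbsolutelyContinuousOnInterval.sum_smul {k : ℕ} {x : ι → ℝ → Fin k → ℂ} {a b : ℝ}
    (h : ∀ i, AbsolutelyContinuousOnInterval (x i) a b) (c : ι → ℂ) :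
    AbsolutelyContinuousOnInterval (fun t => ∑ i, c i • x i t) a b := by
  classical
  suffices H : ∀ s : Finset ι, AbsolutelyContinuousOnInterval (fun t => ∑ i ∈ s, c i • x i t) a b
    from H Finset.univ
  intro s
  induction s using Finset.induction_on with
  | empty =>
    simp only [Finset.sum_empty]
    exact (LipschitzWith.const (0 : Fin k → ℂ)).lipschitzOnWith.absolutelyContinuousOnInterval
  | insert i s hi ih =>
    simp only [Finset.sum_insert hi]
    exact ((h i).const_smul (c i)).fun_add ih

lemma VectorLpLocOn.sum_smul {k : ℕ} {f : ι → ℝ → Fin k → ℂ} {p : ℝ≥0∞} {T : Set ℝ}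
    (h : ∀ i, VectorLpLocOn (f i) p T) (c : ι → ℂ) :
    VectorLpLocOn (fun t => ∑ i, c i • f i t) p T := by
  intro j K hK hKT
  have : MemLp (fun t => ∑ i, c i * f i t j) p (volume.restrict K) :=
    memLp_finsetSum _ fun i _ => (h i j K hK hKT).const_mul (c i)
  simpa only [Finset.sum_apply, Pi.smul_apply, smul_eq_mul] using this

/-- Linear combinations of solutions are solutions. -/
lemma LTVSystem.IsSolution.sum_smul {S : LTVSystem n m} {x : ι → ℝ → Fin n → ℂ}
    {u y : ι → ℝ → Fin m → ℂ} (h : ∀ i, S.IsSolution (x i) (u i) (y i)) (c : ι → ℂ) :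
    S.IsSolution (fun t => ∑ i, c i • x i t) (fun t => ∑ i, c i • u i t)
      (fun t => ∑ i, c i • y i t) where
  state_mem a ha b hb := .sum_smul (fun i => (h i).state_mem a ha b hb) c
  input_mem := .sum_smul (fun i => (h i).input_mem) c
  output_mem := .sum_smul (fun i => (h i).output_mem) c
  state_eq := by
    filter_upwards [ae_all_iff.2 fun i => (h i).state_eq] with t ht
    exact HasDerivAt.sum_smul_of_linear ht c
  output_eq := by
    filter_upwards [ae_all_iff.2 fun i => (h i).output_eq] with t ht
    simp only [ht, mulVec_sum_smul, smul_add, Finset.sum_add_distrib]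

end Solutions

/-! ### Necessity: from dissipation to the KYP inequality. -/

open scoped Matrix.Norms.L2Operator in
lemma MatrixBVLocOn.ae_hasDerivAt {n : ℕ} {Q : ℝ → Matrix (Fin n) (Fin n) ℂ} {T : Set ℝ}
    (hTo : IsOpen T) (hQ : MatrixBVLocOn Q T) :
    ∀ᵐ t ∂(volume.restrict T), ∃ Q', HasDerivAt Q Q' t := by
  have hQ' : LocallyBoundedVariationOn Q T := hQ
  refine ae_restrict_of_forall_Icc hTo fun a ha b hb hsub hab => ?_
  have hbv : BoundedVariationOn Q (Set.uIcc a b) := by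
    have := hQ' a b ha hb
    rwa [Set.inter_eq_right.2 hsub, ← Set.uIcc_of_le hab.le] at this
  filter_upwards [hbv.ae_differentiableAt_of_mem_uIcc] with t ht htab
  rw [Set.uIcc_of_le hab.le] at ht
  exact ⟨_, (ht htab).hasDerivAt⟩

section Necessity

variable {n m : ℕ} {ι : Type*} [Fintype ι]

/-- The supply rate of a linear combination of trajectories with constant inputs, as a real linear
function of the outputs. -/
noncomputable def supplyForm (c : ι → ℂ) (v : Fin m → ℂ) : (ι → Fin m → ℂ) →L[ℝ] ℝ :=
  LinearMap.toContinuousLinearMap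
    { toFun := fun y => (star (∑ i, c i • y i) ⬝ᵥ v).re
      map_add' := fun y z => by
        simp only [Pi.add_apply, smul_add, Finset.sum_add_distrib, star_add, add_dotProduct,
          Complex.add_re]
      map_smul' := fun r y => by
        have : ∑ i, c i • (r • y) i = (r : ℂ) • ∑ i, c i • y i := by
          rw [Finset.smul_sum]
          refine Finset.sum_congr rfl fun i _ => ?_
          ext j
          simp only [Pi.smul_apply, smul_eq_mul, Complex.real_smul]
          ring
        rw [this, star_smul, smul_dotProduct, Complex.star_def, Complex.conj_ofReal, smul_eq_mul,
          Complex.re_ofReal_mul]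
        rfl }

@[simp]
lemma supplyForm_apply (c : ι → ℂ) (v : Fin m → ℂ) (y : ι → Fin m → ℂ) :
    supplyForm c v y = (star (∑ i, c i • y i) ⬝ᵥ v).re := rfl

/-- Along finitely many trajectories with constant inputs, the block form of the KYP inequality is
nonnegative at almost every time, simultaneously for all linear combinations. -/
lemma LTVSystem.IsStorageFunction.ae_kyp_form_nonneg {S : LTVSystem n m}
    {Q : ℝ → Matrix (Fin n) (Fin n) ℂ} (hV : S.IsStorageFunction (quadStorage Q))
    {x : ι → ℝ → Fin n → ℂ} {v : ι → Fin m → ℂ} {y : ι → ℝ → Fin m → ℂ}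
    (h : ∀ i, S.IsSolution (x i) (fun _ => v i) (y i)) {t₀ : ℝ} (ht₀ : t₀ ∈ S.T) :
    ∀ᵐ t ∂(volume.restrict S.T), ∀ Q', HasDerivAt Q Q' t → ∀ c : ι → ℂ,
      0 ≤ (star (Sum.elim (∑ i, c i • x i t) (∑ i, c i • v i)) ⬝ᵥ (fromBlocks
        (-((S.A t)ᴴ * Q t) - Q t * S.A t - Q') ((S.C t)ᴴ - Q t * S.B t)
        (S.C t - (S.B t)ᴴ * Q t) (S.D t + (S.D t)ᴴ) *ᵥ
          Sum.elim (∑ i, c i • x i t) (∑ i, c i • v i))).re := by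
  -- All outputs form one vector-valued function, so differentiating its primitive leaves a null set
  -- independent of `c`. The supply of a combination is then a fixed linear function of this
  -- primitive, because the inputs are constant.
  have hY : ∀ a ∈ S.T, ∀ b ∈ S.T,
      IntervalIntegrable (fun t i => y i t : ℝ → ι → Fin m → ℂ) volume a b :=
    fun a ha b hb => S.intervalIntegrable_of_forall (fun K hK hKT =>
      Integrable.of_eval fun i => Integrable.of_eval fun j =>
        ((h i).output_mem j).integrableOn (by norm_num) hK hKT) ha hb
  filter_upwards [S.ae_hasDerivAt_integral ht₀ hY, ae_restrict_mem S.isOpen_T.measurableSet,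
    ae_all_iff.2 fun i => (h i).state_eq, ae_all_iff.2 fun i => (h i).output_eq]
    with t hYt ht hxt hyt Q' hQ' c
  set u := ∑ i, c i • v i with hu
  have hP : HasDerivAt (fun s => supplyForm c u (∫ r in t₀..s, fun i => y i r))
      (supplyForm c u fun i => y i t) t :=
    (supplyForm c u).hasFDerivAt.comp_hasDerivAt t hYt
  have hX := HasDerivAt.sum_smul_of_linear hxt c
  have hD := hP.sub (hasDerivAt_quadStorage hQ' hX)
  -- Supplied minus stored energy is nondecreasing: this is dissipation for the combined solution.
  have hmono : MonotoneOn (fun s => supplyForm c u (∫ r in t₀..s, fun i => y i r) -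
      quadStorage Q s (∑ i, c i • x i s)) S.T := by
    intro r hr s hs hrs
    have hdis := hV.dissipation _ _ _ (LTVSystem.IsSolution.sum_smul h c) r hr s hs hrs
    have hint : ∫ t in r..s, (star (∑ i, c i • y i t) ⬝ᵥ u).re =
        supplyForm c u (∫ r in t₀..s, fun i => y i r) -
          supplyForm c u (∫ s in t₀..r, fun i => y i s) := by
      rw [← map_sub, intervalIntegral.integral_interval_sub_left (hY _ ht₀ _ hs) (hY _ ht₀ _ hr)]
      exact (supplyForm c u).intervalIntegral_comp_comm (hY _ hr _ hs)
    rw [hint] at hdis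
    simp only
    linarith
  have h0 := hmono.derivWithin_nonneg (x := t)
  rw [derivWithin_of_mem_nhds (S.isOpen_T.mem_nhds ht)] at h0
  have h1 := h0.trans_eq hD.deriv
  have hy : ∑ i, c i • y i t = S.C t *ᵥ (∑ i, c i • x i t) + S.D t *ᵥ u := by
    simp only [hyt, hu, mulVec_sum_smul, smul_add, Finset.sum_add_distrib]
  rw [supplyForm_apply, hy] at h1
  rw [kyp_form_re]
  linarith

lemma Matrix.isHermitian_kyp {A Q Q' : Matrix (Fin n) (Fin n) ℂ} {B : Matrix (Fin n) (Fin m) ℂ}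
    {C : Matrix (Fin m) (Fin n) ℂ} {D : Matrix (Fin m) (Fin m) ℂ} (hQ : Q.IsHermitian)
    (hQ' : Q'.IsHermitian) :
    (fromBlocks (-(Aᴴ * Q) - Q * A - Q') (Cᴴ - Q * B) (C - Bᴴ * Q) (D + Dᴴ)).IsHermitian := by
  refine IsHermitian.fromBlocks ?_ ?_ ?_
  · rw [IsHermitian, conjTranspose_sub, conjTranspose_sub, conjTranspose_neg, conjTranspose_mul,
      conjTranspose_mul, conjTranspose_conjTranspose, hQ.eq, hQ'.eq]
    abel
  · rw [conjTranspose_sub, conjTranspose_mul, conjTranspose_conjTranspose, hQ.eq]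
  · rw [IsHermitian, conjTranspose_add, conjTranspose_conjTranspose, add_comm]

lemma Matrix.IsHermitian.posSemidef_of_re_nonneg {κ : Type*} [Fintype κ] {M : Matrix κ κ ℂ}
    (hM : M.IsHermitian) (h : ∀ z, 0 ≤ (star z ⬝ᵥ (M *ᵥ z)).re) : M.PosSemidef := by
  refine .of_dotProduct_mulVec_nonneg hM fun z => Complex.le_def.2 ⟨h z, ?_⟩
  exact (hM.im_star_dotProduct_mulVec_self z).symm

theorem LTVSystem.IsStorageFunction.solvesKYP {S : LTVSystem n m}
    {Q : ℝ → Matrix (Fin n) (Fin n) ℂ} (hV : S.IsStorageFunction (quadStorage Q))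
    (hQ : ∀ t ∈ S.T, (Q t).IsHermitian) (hbv : MatrixBVLocOn Q S.T) : S.SolvesKYP Q := by
  have key : ∀ t₀ ∈ S.T, ∃ N ∈ nhds t₀, ∀ᵐ t ∂(volume.restrict S.T), t ∈ N →
      ∃ Q' : Matrix (Fin n) (Fin n) ℂ, HasDerivAt Q Q' t ∧ (fromBlocks
        (-((S.A t)ᴴ * Q t) - Q t * S.A t - Q') ((S.C t)ᴴ - Q t * S.B t)
        (S.C t - (S.B t)ᴴ * Q t) (S.D t + (S.D t)ᴴ)).PosSemidef := by
    intro t₀ ht₀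
    choose x hx hx0 using fun i : Fin n ⊕ Fin m => S.exists_isSolution_const ht₀
      (fun j => (Pi.single i 1 : Fin n ⊕ Fin m → ℂ) (Sum.inl j))
      (fun j => (Pi.single i 1 : Fin n ⊕ Fin m → ℂ) (Sum.inr j))
    set v : Fin n ⊕ Fin m → Fin m → ℂ :=
      fun i j => (Pi.single i 1 : Fin n ⊕ Fin m → ℂ) (Sum.inr j) with hv
    -- Column `i` is `(xᵢ(t), vᵢ)`, so `Z t₀` is the identity and `Z t` is invertible near `t₀`.
    set Z : ℝ → Matrix (Fin n ⊕ Fin m) (Fin n ⊕ Fin m) ℂ :=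
      fun t => Matrix.of fun p i => Sum.elim (x i t) (v i) p with hZ
    have hZ0 : Z t₀ = 1 := by
      ext p i
      rw [Matrix.one_apply]
      change Sum.elim (x i t₀) (v i) p = _
      rcases p with p | p <;> simp [hx0, hv, Pi.single_apply]
    have hZc : ContinuousAt (fun t => (Z t).det) t₀ := by
      refine Continuous.continuousAt (f := Matrix.det) (continuous_id.matrix_det) |>.comp ?_
      refine continuousAt_pi.2 fun p => continuousAt_pi.2 fun i => ?_
      rcases p with p | p
      · exact (continuousAt_pi.1 (((hx i).state_mem.continuousOn S.isOpen_T).continuousAt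
          (S.isOpen_T.mem_nhds ht₀)) p)
      · exact continuousAt_const
    have hN : ∀ᶠ t in nhds t₀, (Z t).det ≠ 0 := hZc.eventually_ne (by simp [hZ0])
    refine ⟨_, hN, ?_⟩
    filter_upwards [hV.ae_kyp_form_nonneg hx ht₀, hbv.ae_hasDerivAt S.isOpen_T,
      ae_restrict_mem S.isOpen_T.measurableSet] with t hform ⟨Q', hQ'⟩ ht hdet
    refine ⟨Q', hQ', (isHermitian_kyp (hQ t ht) (hQ'.isHermitian ?_)).posSemidef_of_re_nonneg
      fun z => ?_⟩
    · filter_upwards [S.isOpen_T.mem_nhds ht] with s hs using hQ s hs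
    -- The coefficients are the coordinates of `z` in the basis of columns of `Z t`.
    · have hz : Sum.elim (∑ i, ((Z t)⁻¹ *ᵥ z) i • x i t) (∑ i, ((Z t)⁻¹ *ᵥ z) i • v i) = z := by
        have h1 : Z t *ᵥ ((Z t)⁻¹ *ᵥ z) = z := by
          rw [mulVec_mulVec, Matrix.mul_nonsing_inv _ (Ne.isUnit hdet), one_mulVec]
        conv_rhs => rw [← h1]
        ext p
        rcases p with p | p <;>
          simp [hZ, mulVec, dotProduct, Finset.sum_apply, mul_comm]
      have h2 := hform Q' hQ' ((Z t)⁻¹ *ᵥ z)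
      rwa [hz] at h2
  -- The neighbourhood depends on `t₀`; a set that is null near each of its points is null.
  rw [LTVSystem.SolvesKYP, ae_restrict_iff' S.isOpen_T.measurableSet, ae_iff]
  refine measure_null_of_locally_null _ fun t₀ ht₀ => ?_
  simp only [Set.mem_ofPred_eq, Classical.not_imp] at ht₀
  obtain ⟨N, hN, hae⟩ := key t₀ ht₀.1
  rw [ae_restrict_iff' S.isOpen_T.measurableSet, ae_iff] at hae
  refine ⟨_, Filter.inter_mem self_mem_nhdsWithin (mem_nhdsWithin_of_mem_nhds hN),
    measure_mono_null (fun s hs => ?_) hae⟩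
  simp only [Set.mem_inter_iff, Set.mem_ofPred_eq, Classical.not_imp] at hs ⊢
  exact ⟨hs.1.1, hs.2, hs.1.2⟩

end Necessity

theorem corollary5p4 {n m : ℕ} (S : LTVSystem n m) (Q : ℝ → Matrix (Fin n) (Fin n) ℂ)
    (hQ : ∀ t ∈ S.T, (Q t).PosSemidef) :
    (MatrixBVLocOn Q S.T → S.IsStorageFunction (quadStorage Q) → S.SolvesKYP Q) ∧
    (MatrixAUCLocOn Q S.T → S.SolvesKYP Q → S.IsStorageFunction (quadStorage Q)) :=
  ⟨fun hbv hV => hV.solvesKYP (fun t ht => (hQ t ht).isHermitian) hbv,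
    fun hauc hK => hK.isStorageFunction hQ hauc⟩
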